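/- All graphs are finite and loopless and may have parallel edges. For a graph $G$ and $S\subseteq V(G)$, let $E_G(S)$ be the multiset of edges with exactly one end in $S$. A graph parameter $\mathbf p_1$ is upper bounded by $\mathbf p_2$, written $\mathbf p_1\lesssim\mathbf p_2$, if there is $f:\mathbb N\to\mathbb N$ with $\mathbf p_1(G)\le f(\mathbf p_2(G))$ for every graph $G$; $\mathbf p_1$ and $\mathbf p_2$ are parametrically incomparable if neither $\mathbf p_1\lesssim \mathbf p_2$ nor $\mathbf p_2\lesssim\mathbf p_1$. *Edge-treewidth.* For a linear ordering $L=\langle x_1,\dots,x_n\rangle$ of $V(G)$ let $S_i=\{x_i,\dots,x_n\}$ and let $C_i$ be the vertex set of the connected component of $G[S_i]$ containing $x_i$. Then $\mathbf{etw}(G)=\min_L\max_i |E_G(C_i)|$. *Tree-cut width.* A tree-cut decomposition of $G$ is a finite tree $T$ with a family $(X_t)_{t\in V(T)}$ of pairwise disjoint, possibly empty sets with union $V(G)$. The adhesion of $e\in E(T)$ is the number of edges of $G$ between $\bigcup_{t\in T_1}X_t$ and $\bigcup_{t\in T_2}X_t$, where $T_1,T_2$ are the components of $T-e$. The torso $H_t$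 is obtained from $G$ by consolidating, for each component $T'$ of $T-t$, the set $\bigcup_{s\in T'}X_s$ to a single vertex, keeping parallel edges and removing loops. The 3-center of $(H_t,X_t)$ is obtained from $H_t$ by exhaustively suppressing vertices outside $X_t$ of degree at most two (delete the vertex and, if its degree is two, join its two neighbours by a new edge, omitted if it would be a loop). The width is the maximum over all adhesions of edges of $T$ and all numbers of vertices of the 3-centers of $(H_t,X_t)$, $t\in V(T)$; $\mathbf{tcw}(G)$ is the minimum width of a tree-cut decomposition of $G$. *Immersions, walls, thetas.* Lifting two edges $xy,xz$ with $y\ne z$ means to replace them by an edge $yz$. A graph $H$ is an immersion of $G$, $H\le_{\sf im}G$, if a graph isomorphic to $H$ is obtained from $G$ by taking subgraphs and lifting pairs of incident edges. For $r\ge2$ the wall $W_r$ is obtained from the grid on $[2r]\times[r]$ by removing the edges $\{(x,y),(x,y+1)\}$ with $x+y$ odd and then all vertices of degree one. Let $\mathbf w(G)$ be the largest $i\ge 2$ with $W_i\le_{\sf im}G$ (and $0$ if there is none). For $i\ge1$, $\theta_i$ consists of two vertices joined by $i$ parallel edges. For $i\ge2$, $Z_i$ is obtained from $|E(W_i)|$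 disjoint copies of $\theta_3$ by identifying one vertex of each copy to a single vertex. **Theorem.** 1. $\mathbf{tcw}$ and $\mathbf{etw}$ are parametrically incomparable, and so are $\mathbf w$ and $\mathbf{etw}$. 2. The values $\mathbf{tcw}(\theta_i)$ and $\mathbf w(\theta_i)$, $i\ge1$, are bounded, while the values $\mathbf{etw}(\theta_i)$, $i\ge 1$, are unbounded. 3. For every $i\ge2$, $W_i\le_{\sf im}Z_i$ and hence $\mathbf w(Z_i)\ge i$; the values $\mathbf{tcw}(Z_i)$, $i\ge2$, are unbounded, while the values $\mathbf{etw}(Z_i)$, $i\ge2$, are bounded. -/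

import Mathlib

noncomputable section

/-- A finite loopless graph, possibly with multiple edges: a finite vertex set together with a
multiset of unordered pairs of distinct vertices. -/
@[ext]
structure Multigraph (α : Type*) where
  verts : Finset α
  edges : Multiset (Sym2 α)
  mem_verts : ∀ e ∈ edges, ∀ v ∈ e, v ∈ verts
  loopless : ∀ e ∈ edges, ¬ e.IsDiag

namespace Multigraph

variable {α β : Type*}

open Classical in
/-- `E_G(S)`: the edges (with multiplicity) with one end in `S` and one end not in `S`. -/
def boundary (G : Multigraph α) (S : Set α) : Multiset (Sym2 α) :=
  G.edges.filter fun e => (∃ x ∈ e, x ∈ S) ∧ ∃ y ∈ e, y ∉ S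

/-- `|E_G(S)|`. -/
def cutSize (G : Multigraph α) (S : Set α) : ℕ :=
  (G.boundary S).card

/-- The edge-degree of a vertex. -/
def edeg (G : Multigraph α) (v : α) : ℕ :=
  G.cutSize {v}

open Classical in
/-- The subgraph `G[S]` induced by the vertices of `G` in `S`. -/
def induce (G : Multigraph α) (S : Set α) : Multigraph α where
  verts := G.verts.filter (· ∈ S)
  edges := G.edges.filter fun e => ∀ v ∈ e, v ∈ S
  mem_verts := by
    intro e he v hv
    rw [Multiset.mem_filter] at he
    exact Finset.mem_filter.2 ⟨G.mem_verts e he.1 v hv, he.2 v hv⟩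
  loopless := fun e he => G.loopless e (Multiset.mem_filter.1 he).1

open Classical in
/-- The graph with finite vertex set `s` and with the edges of the simple graph `H` between
elements of `s`. -/
def ofSimple (s : Finset α) (H : SimpleGraph α) : Multigraph α where
  verts := s
  edges := (s.sym2.filter (· ∈ H.edgeSet)).val
  mem_verts := by
    intro e he v hv
    have he' := (Finset.mem_filter.1 he).1
    exact Finset.mem_sym2_iff.1 he' v hv
  loopless := fun e he => H.not_isDiag_of_mem_edgeSet (Finset.mem_filter.1 he).2

/-! ### Edge-treewidth -/

/-- `C_G(S, v)`, for a vertex `v ∈ S`: the vertex set of the connected component of `G[S]` that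
contains `v`. -/
def component (G : Multigraph α) (S : Set α) (v : α) : Set α :=
  {w | Relation.ReflTransGen (fun a b => a ∈ S ∧ b ∈ S ∧ s(a, b) ∈ G.edges) v w}

/-- Layouts of `G`: linear orderings `⟨x_0, …, x_{n-1}⟩` of the vertices of `G`. -/
abbrev Layout (G : Multigraph α) : Type _ :=
  Fin G.verts.card ≃ G.verts

/-- `S_i = {x_i, x_{i+1}, …}`. -/
def Layout.suffix {G : Multigraph α} (L : G.Layout) (i : Fin G.verts.card) : Set α :=
  {x | ∃ j, i ≤ j ∧ (L j : α) = x}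

/-- The cost `|E_G(C_G(S_i, x_i))|` of position `i` of a layout. -/
def Layout.cost {G : Multigraph α} (L : G.Layout) (i : Fin G.verts.card) : ℕ :=
  G.cutSize (G.component (L.suffix i) (L i))

/-- The maximum cost of a position of the layout. -/
def Layout.width {G : Multigraph α} (L : G.Layout) : ℕ :=
  Finset.univ.sup L.cost

/-- Edge-treewidth: the minimum of the maximum cost over all layouts. -/
def etw (G : Multigraph α) : ℕ :=
  ⨅ L : G.Layout, L.width

/-! ### Tree-cut width -/

/-- A tree-cut decomposition of `G`: a finite tree together with a near-partition of the vertices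
of `G` (empty parts are allowed) into parts indexed by the nodes. The near-partition is given by
the map `home` sending a vertex to the node whose part contains it; the values of `home` outside
`G.verts` play no role. -/
structure TreeCutDecomposition (G : Multigraph α) where
  size : ℕ
  tree : SimpleGraph (Fin size)
  isTree : tree.IsTree
  home : α → Fin size

namespace TreeCutDecomposition

variable {G : Multigraph α} (D : TreeCutDecomposition G)

/-- The set of `x` whose node lies on the side of `u` after deletion of the tree edge `uv`. -/
def side (u v : Fin D.size) : Set α :=
  {x | (D.tree.deleteEdges {s(u, v)}).Reachable (D.home x) u}

/-- The adhesion of the tree edge `uv`: the number of edges of `G` between its two sides. -/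
def adhesion (u v : Fin D.size) : ℕ :=
  G.cutSize (D.side u v)

/-- The components of the tree minus the node `t`. -/
abbrev Branch (t : Fin D.size) : Type :=
  (D.tree.induce {t}ᶜ).ConnectedComponent

open Classical in
/-- The map which fixes the vertices in the part of `t` and consolidates, for every component of
the tree minus `t`, all vertices in parts of that component to a single vertex. -/
def toTorso (t : Fin D.size) (x : α) : α ⊕ D.Branch t :=
  if h : D.home x = t then Sum.inl x
  else Sum.inr ((D.tree.induce {t}ᶜ).connectedComponentMk ⟨D.home x, h⟩)

open Classical in
/-- The torso at `t`: consolidate every component of the tree minus `t` to a single vertex, keep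
parallel edges and remove loops. -/
def torso (t : Fin D.size) : Multigraph (α ⊕ D.Branch t) where
  verts := (G.verts.filter (D.home · = t)).image Sum.inl ∪
    (Set.finite_range (Sum.inr : D.Branch t → α ⊕ D.Branch t)).toFinset
  edges := (G.edges.map (Sym2.map (D.toTorso t))).filter fun e => ¬ e.IsDiag
  mem_verts := by
    intro e he v hv
    obtain ⟨e', he', rfl⟩ := Multiset.mem_map.1 (Multiset.mem_filter.1 he).1
    obtain ⟨x, hx, rfl⟩ := Sym2.mem_map.1 hv
    have hxG := G.mem_verts e' he' x hx
    by_cases h : D.home x = t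
    · simp [toTorso, h, hxG]
    · simp [toTorso, h]
  loopless := fun e he => (Multiset.mem_filter.1 he).2

/-- The vertices of the torso at `t` that are vertices of `G` (in the part of `t`). -/
def core (t : Fin D.size) : Set (α ⊕ D.Branch t) :=
  {w | ∃ x ∈ G.verts, D.home x = t ∧ w = Sum.inl x}

end TreeCutDecomposition

open Classical in
/-- `H'` arises from `H` by suppressing the vertex `v` of degree at most two: `v` is deleted and,
if `v` has degree two, its two neighbours are joined by a new edge (which is dropped if it would
be a loop, that is, if the two edges at `v` are parallel). -/
def IsSuppression (H : Multigraph β) (v : β) (H' : Multigraph β) : Prop :=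
  v ∈ H.verts ∧ H'.verts = H.verts.erase v ∧
    ((H.edeg v ≤ 1 ∧ H'.edges = H.edges.filter (v ∉ ·)) ∨
      ∃ a b, H.boundary {v} = {s(v, a), s(v, b)} ∧
        H'.edges = (if a = b then 0 else {s(a, b)}) + H.edges.filter (v ∉ ·))

/-- `K` is the 3-center of `(H, X)`: it is obtained from `H` by exhaustively suppressing vertices
outside `X` of degree at most two. -/
def IsThreeCenter (H : Multigraph β) (X : Set β) (K : Multigraph β) : Prop :=
  Relation.ReflTransGen (fun H₁ H₂ => ∃ v ∉ X, IsSuppression H₁ v H₂) H K ∧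
    ∀ v ∈ K.verts, v ∉ X → 3 ≤ K.edeg v

/-- The number of vertices of the 3-center of `(H, X)`. (The 3-center exists and is unique, so the
infimum is over a one-element set.) -/
def threeCenterSize (H : Multigraph β) (X : Set β) : ℕ :=
  sInf {n | ∃ K, IsThreeCenter H X K ∧ K.verts.card = n}

open Classical in
/-- The width of a tree-cut decomposition: the maximum over all adhesions of tree edges and all
orders of the 3-centers of the torsos. -/
def TreeCutDecomposition.width {G : Multigraph α} (D : TreeCutDecomposition G) : ℕ :=
  max
    ((Finset.univ.filter fun p : Fin D.size × Fin D.size => D.tree.Adj p.1 p.2).sup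
      fun p => D.adhesion p.1 p.2)
    (Finset.univ.sup fun t => threeCenterSize (D.torso t) (D.core t))

/-- Tree-cut width: the minimum width of a tree-cut decomposition. -/
def tcw (G : Multigraph α) : ℕ :=
  ⨅ D : TreeCutDecomposition G, D.width

/-! ### Immersions -/

/-- `K` is a subgraph of `G`. -/
def IsSubgraph (K G : Multigraph α) : Prop :=
  K.verts ⊆ G.verts ∧ K.edges ≤ G.edges

/-- `K` arises from `G` by lifting two edges `xy`, `xz` with `y ≠ z`: both are removed and the edge
`yz` is added. -/
def IsLifting (G K : Multigraph α) : Prop :=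
  K.verts = G.verts ∧ ∃ x y z F, y ≠ z ∧
    G.edges = s(x, y) ::ₘ s(x, z) ::ₘ F ∧ K.edges = s(y, z) ::ₘ F

open Classical in
/-- `H` and `K` are isomorphic. -/
def IsIso (H : Multigraph β) (K : Multigraph α) : Prop :=
  ∃ f : β → α, Set.InjOn f H.verts ∧ H.verts.image f = K.verts ∧
    H.edges.map (Sym2.map f) = K.edges

/-- `H` is an immersion of `G`: up to isomorphism, `H` is obtained from `G` by taking subgraphs and
lifting pairs of incident edges. -/
def IsImmersion (H : Multigraph β) (G : Multigraph α) : Prop :=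
  ∃ K : Multigraph α,
    Relation.ReflTransGen (fun G₁ G₂ => IsSubgraph G₂ G₁ ∨ IsLifting G₁ G₂) G K ∧ IsIso H K

/-! ### Thetas, walls and the graphs `Z_i` -/

/-- The `i`-theta: two vertices joined by `i` parallel edges. -/
def theta (i : ℕ) : Multigraph Bool where
  verts := Finset.univ
  edges := Multiset.replicate i s(false, true)
  mem_verts := by simp
  loopless := by
    intro e he
    rw [Multiset.eq_of_mem_replicate he]
    simp

/-- The infinite grid on `ℕ × ℕ` without its vertical edges `{(x, y), (x, y + 1)}` for odd
`x + y`. -/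
def brickLattice : SimpleGraph (ℕ × ℕ) :=
  SimpleGraph.fromRel fun p q =>
    q = (p.1 + 1, p.2) ∨ (q = (p.1, p.2 + 1) ∧ ¬ Odd (p.1 + p.2))

/-- The `(2r × r)`-grid on `[2r] × [r]` without its vertical edges `{(x, y), (x, y + 1)}` for odd
`x + y`. -/
def preWall (r : ℕ) : Multigraph (ℕ × ℕ) :=
  ofSimple (Finset.Icc 1 (2 * r) ×ˢ Finset.Icc 1 r) brickLattice

/-- The `r`-wall (for `r ≥ 2`): remove from `preWall r` all vertices of degree one. -/
def wall (r : ℕ) : Multigraph (ℕ × ℕ) :=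
  (preWall r).induce {v | (preWall r).edeg v ≠ 1}

/-- `n` copies of the `3`-theta with one vertex of each copy identified to the single vertex
`none`. -/
def thetaBouquet (n : ℕ) : Multigraph (Option (Fin n)) where
  verts := Finset.univ
  edges := ∑ j : Fin n, Multiset.replicate 3 s(none, some j)
  mem_verts := by simp
  loopless := by
    intro e he
    obtain ⟨j, -, hj⟩ := Multiset.mem_sum.1 he
    rw [Multiset.eq_of_mem_replicate hj]
    simp

/-- The graph `Z_i`: `|E(W_i)|` copies of the `3`-theta glued at one vertex. -/
def zGraph (i : ℕ) : Multigraph (Option (Fin (wall i).edges.card)) :=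
  thetaBouquet (wall i).edges.card

/-- The largest `i ≥ 2` such that the `i`-wall is an immersion of `G` (and `0` if there is none). -/
def wallImmersionNumber (G : Multigraph α) : ℕ :=
  sSup {i | 2 ≤ i ∧ IsImmersion (wall i) G}

end Multigraph

/-! ### Graph parameters -/

/-- A graph parameter is a function mapping graphs to non-negative integers. -/
abbrev GraphParameter : Type 1 :=
  ∀ α : Type, Multigraph α → ℕ

namespace GraphParameter

/-- `p ≲ q`: there is a function `f` with `p(G) ≤ f(q(G))` for every graph `G`. -/
def UpperBounded (p q : GraphParameter) : Prop :=
  ∃ f : ℕ → ℕ, ∀ (α : Type) (G : Multigraph α), p α G ≤ f (q α G)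

/-- `p` and `q` are parametrically incomparable. -/
def Incomparable (p q : GraphParameter) : Prop :=
  ¬ UpperBounded q p ∧ ¬ UpperBounded p q

/-- Edge-treewidth. -/
def etw : GraphParameter := fun _ G => G.etw

/-- Tree-cut width. -/
def tcw : GraphParameter := fun _ G => G.tcw

/-- The maximum size of a wall contained as an immersion. -/
def wallImmersion : GraphParameter := fun _ G => G.wallImmersionNumber

end GraphParameter

end

/-!
Thetas. A graph has at least as many vertices as any of its immersions, and the wall `W_r` has at
least `r` vertices; moreover `tcw G ≤ |V(G)|` by the decomposition with a single node. So both
`tcw` and the size of an immersed wall are bounded on the graphs `θ_i`. In every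
layout the last vertex is a component of its own, hence `etw` is at least the minimum
degree, which is `i` for `θ_i`.

Bouquets. The graph `Z_i` is a star whose leaves are joined to the centre by three parallel edges.
A layout starting with the centre has cost `0` at the centre and `3` at every leaf, so
`etw Z_i ≤ 3`. The wall `W_i` has maximum degree three and at least as many edges as vertices: put
its vertices on leaves of `Z_i` and lift, for each edge of the wall, one edge at each of its two
ends through the centre.

For a lower bound on `tcw Z_i`, take a tree-cut decomposition of width `w` and the node `t` whose
part contains the centre. A torso vertex at `t` that represents a leaf has degree at least three,
so exhaustive suppression removes only isolated vertices and never one of these. Hence the leaves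
are spread over at most `w` vertices of the torso. A branch contains at most `w` leaves, all of them
contributing to the adhesion of the edge leading to it, so `Z_i` has at most `(w + 1) * w` leaves.
-/

namespace Multigraph

variable {α β : Type*}

/-! ### Degrees -/

theorem edeg_eq_countP [DecidableEq α] (G : Multigraph α) (v : α) :
    G.edeg v = G.edges.countP (v ∈ ·) := by
  classical
  rw [edeg, cutSize, boundary, ← Multiset.countP_eq_card_filter]
  refine Multiset.countP_congr rfl fun e he => ?_
  have hloop := G.loopless e he
  induction e with
  | _ a b =>
    simp only [Sym2.mk_isDiag_iff] at hloop
    simp only [Sym2.mem_iff, Set.mem_singleton_iff, exists_eq_or_imp, exists_eq_left]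
    grind

theorem edeg_eq_zero_iff {G : Multigraph α} {v : α} : G.edeg v = 0 ↔ ∀ e ∈ G.edges, v ∉ e := by
  classical
  rw [edeg_eq_countP, Multiset.countP_eq_zero]

theorem edeg_eq_zero_of_notMem_verts {G : Multigraph α} {v : α} (hv : v ∉ G.verts) :
    G.edeg v = 0 :=
  edeg_eq_zero_iff.2 fun e he hve => hv (G.mem_verts e he v hve)

theorem edeg_mono {G K : Multigraph α} (h : K.edges ≤ G.edges) (v : α) : K.edeg v ≤ G.edeg v := by
  classical
  rw [edeg_eq_countP, edeg_eq_countP]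
  exact Multiset.countP_le_of_le _ h

theorem edeg_congr {G K : Multigraph α} (h : K.edges = G.edges) (v : α) : K.edeg v = G.edeg v :=
  (edeg_mono h.le v).antisymm (edeg_mono h.ge v)

theorem count_le_edeg [DecidableEq α] (G : Multigraph α) {v : α} {e : Sym2 α} (hv : v ∈ e) :
    G.edges.count e ≤ G.edeg v := by
  rw [edeg_eq_countP, Multiset.count, Multiset.countP_eq_card_filter,
    Multiset.countP_eq_card_filter]
  exact Multiset.card_le_card (Multiset.monotone_filter_right _ fun _ h => h ▸ hv)

theorem two_le_edeg {G : Multigraph α} {v : α} {e f : Sym2 α} (he : e ∈ G.edges)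
    (hf : f ∈ G.edges) (hef : e ≠ f) (hve : v ∈ e) (hvf : v ∈ f) : 2 ≤ G.edeg v := by
  classical
  rw [edeg_eq_countP, Multiset.countP_eq_card_filter]
  have hsub : ({e, f} : Finset (Sym2 α)) ⊆ (G.edges.filter (v ∈ ·)).toFinset := by
    simp [Finset.insert_subset_iff, he, hf, hve, hvf]
  exact (Finset.card_pair hef).ge.trans
    ((Finset.card_le_card hsub).trans (Multiset.toFinset_card_le _))

/-- The multiset of ends of the edges of `G`, in which every vertex occurs as often as its degree;
lifting at a common neighbour consumes one edge for each of these ends. -/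
def ends (G : Multigraph α) : Multiset α :=
  G.edges.bind Sym2.toMultiset

theorem count_toMultiset_of_not_isDiag [DecidableEq α] {e : Sym2 α} (he : ¬ e.IsDiag) (v : α) :
    e.toMultiset.count v = if v ∈ e then 1 else 0 := by
  induction e with
  | _ a b =>
    change Multiset.count v {a, b} = _
    simp only [Sym2.mk_isDiag_iff] at he
    simp only [Multiset.insert_eq_cons, Multiset.count_cons, Multiset.count_singleton, Sym2.mem_iff]
    grind

theorem count_ends [DecidableEq α] (G : Multigraph α) (v : α) : G.ends.count v = G.edeg v := by
  rw [ends, Multiset.count_bind, edeg_eq_countP, Multiset.countP_eq_card_filter,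
    Multiset.filter_eq_bind, Multiset.card_bind]
  refine congrArg Multiset.sum (Multiset.map_congr rfl fun e he => ?_)
  rw [count_toMultiset_of_not_isDiag (G.loopless e he), Function.comp_apply]
  split_ifs <;> rfl

/-! ### Immersions -/

/-- The image of `G` under a map that is injective on its vertices. -/
noncomputable def map (f : α → β) (G : Multigraph α) (hf : Set.InjOn f G.verts) : Multigraph β where
  verts := (G.verts.finite_toSet.image f).toFinset
  edges := G.edges.map (Sym2.map f)
  mem_verts := by
    simp only [Multiset.mem_map, forall_exists_index, and_imp, forall_apply_eq_imp_iff₂,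
      Sym2.mem_map]
    exact fun e he x hx => (Set.Finite.mem_toFinset _).2 ⟨x, G.mem_verts e he x hx, rfl⟩
  loopless := by
    simp only [Multiset.mem_map, forall_exists_index, and_imp, forall_apply_eq_imp_iff₂]
    intro e he
    have hloop := G.loopless e he
    have hmem := G.mem_verts e he
    induction e with
    | _ a b =>
      exact fun h => hloop (hf (hmem a (Sym2.mem_mk_left a b)) (hmem b (Sym2.mem_mk_right a b)) h)

theorem mem_verts_map {f : α → β} {G : Multigraph α} {hf : Set.InjOn f G.verts} {w : β} :
    w ∈ (G.map f hf).verts ↔ ∃ v ∈ G.verts, f v = w :=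
  Set.Finite.mem_toFinset _

theorem isIso_map {f : α → β} {G : Multigraph α} (hf : Set.InjOn f G.verts) :
    IsIso G (G.map f hf) :=
  ⟨f, hf, by ext w; simp [mem_verts_map], rfl⟩

theorem edeg_map {f : α → β} {G : Multigraph α} (hf : Set.InjOn f G.verts) {v : α}
    (hv : v ∈ G.verts) : (G.map f hf).edeg (f v) = G.edeg v := by
  classical
  rw [edeg_eq_countP, edeg_eq_countP, map, Multiset.countP_map, ← Multiset.countP_eq_card_filter]
  refine Multiset.countP_congr rfl fun e he => ?_
  rw [Sym2.mem_map, eq_iff_iff]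
  exact ⟨fun ⟨x, hx, hxv⟩ => hf (G.mem_verts e he x hx) hv hxv ▸ hx, fun h => ⟨v, h, rfl⟩⟩

/-- `K` is obtained from `G` by taking subgraphs and lifting pairs of incident edges. -/
def ReducesTo (G K : Multigraph α) : Prop :=
  Relation.ReflTransGen (fun G₁ G₂ => IsSubgraph G₂ G₁ ∨ IsLifting G₁ G₂) G K

theorem ReducesTo.verts_subset {G K : Multigraph α} (h : ReducesTo G K) : K.verts ⊆ G.verts := by
  induction h with
  | refl => exact subset_rfl
  | tail _ hstep ih => exact (hstep.elim And.left fun h => h.1.subset).trans ih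

theorem IsImmersion.card_verts_le {H : Multigraph β} {G : Multigraph α} (h : IsImmersion H G) :
    H.verts.card ≤ G.verts.card := by
  classical
  obtain ⟨K, hGK, f, hf, himage, -⟩ := h
  calc H.verts.card = K.verts.card := by rw [← himage, Finset.card_image_of_injOn hf]
    _ ≤ G.verts.card := Finset.card_le_card (ReducesTo.verts_subset hGK)

theorem reducesTo_of_edges_eq_star (c : α) {G K : Multigraph α} (E R : Multiset (Sym2 α))
    (hV : K.verts = G.verts) (hK : K.edges = E + R)
    (hG : G.edges = (E.bind Sym2.toMultiset).map (s(c, ·)) + R) : ReducesTo G K := by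
  induction E using Multiset.induction_on generalizing R G with
  | empty =>
    have hKG : K = G := Multigraph.ext hV (by simpa [hK] using hG.symm)
    exact hKG ▸ .refl
  | cons e E ih =>
    induction e with
    | _ a b =>
      set F := (E.bind Sym2.toMultiset).map (s(c, ·)) + R with hF
      replace hG : G.edges = s(c, a) ::ₘ s(c, b) ::ₘ F := by
        have htoMultiset : s(a, b).toMultiset = a ::ₘ b ::ₘ 0 := rfl
        simp [hG, hF, htoMultiset]
      have hab : s(a, b) ∈ K.edges := by simp [hK]
      let G' : Multigraph α :=
        { verts := G.verts
          edges := s(a, b) ::ₘ F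
          mem_verts := by
            refine Multiset.forall_mem_cons.2 ⟨hV ▸ K.mem_verts _ hab, fun e he => ?_⟩
            exact G.mem_verts e (by simp [hG, he])
          loopless := by
            refine Multiset.forall_mem_cons.2 ⟨K.loopless _ hab, fun e he => ?_⟩
            exact G.loopless e (by simp [hG, he]) }
      have hlift : IsLifting G G' :=
        ⟨rfl, c, a, b, F, fun h => K.loopless _ hab (Sym2.mk_isDiag_iff.2 h), hG, rfl⟩
      exact .head (Or.inr hlift) (ih (G := G') (s(a, b) ::ₘ R) hV (by simp [hK]) (by simp [G', hF]))

/-- Every edge `ab` of `H` is obtained by lifting an edge `ca` with an edge `cb`. -/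
theorem reducesTo_of_edeg_le_count [DecidableEq α] {G H : Multigraph α} {c : α}
    (hV : H.verts ⊆ G.verts) (hcount : ∀ v, H.edeg v ≤ G.edges.count s(c, v)) :
    ReducesTo G H := by
  have hinj : Function.Injective fun v : α => s(c, v) := fun _ _ h => Sym2.congr_right.1 h
  have hle : H.ends.map (s(c, ·)) ≤ G.edges := by
    rw [Multiset.le_iff_count]
    intro e
    by_cases he : ∃ v, s(c, v) = e
    · obtain ⟨v, rfl⟩ := he
      rw [Multiset.count_map_eq_count' _ _ hinj, count_ends]
      exact hcount v
    · rw [Multiset.count_eq_zero_of_notMem fun h => he (by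
        obtain ⟨v, -, hv⟩ := Multiset.mem_map.1 h; exact ⟨v, hv⟩)]
      exact Nat.zero_le _
  let G₀ : Multigraph α :=
    { verts := G.verts
      edges := H.ends.map (s(c, ·))
      mem_verts := fun e he => G.mem_verts e (Multiset.mem_of_le hle he)
      loopless := fun e he => G.loopless e (Multiset.mem_of_le hle he) }
  let H₀ : Multigraph α :=
    { verts := G.verts
      edges := H.edges
      mem_verts := fun e he v hv => hV (H.mem_verts e he v hv)
      loopless := H.loopless }
  have hlift : ReducesTo G₀ H₀ :=
    reducesTo_of_edges_eq_star c H.edges 0 rfl (add_zero _).symm (add_zero _).symm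
  exact .head (b := G₀) (Or.inl ⟨subset_rfl, hle⟩) (hlift.tail (Or.inl ⟨hV, le_rfl⟩))

theorem isImmersion_of_forall_le_count [DecidableEq α] {H : Multigraph β} {G : Multigraph α}
    {c : α} {A : Finset α} {d : ℕ} (hA : A ⊆ G.verts) (hcard : H.verts.card ≤ A.card)
    (hdeg : ∀ v ∈ H.verts, H.edeg v ≤ d) (hcount : ∀ a ∈ A, d ≤ G.edges.count s(c, a)) :
    IsImmersion H G := by
  have : Nonempty α := ⟨c⟩
  obtain ⟨f, hfA, hf⟩ := H.verts.finite_toSet.exists_injOn_of_encard_le (t := (A : Set α))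
    (by simpa only [Set.encard_coe_eq_coe_finsetCard, Nat.cast_le] using hcard)
  refine ⟨H.map f hf, reducesTo_of_edeg_le_count (c := c) (fun w hw => ?_) fun w => ?_,
    isIso_map hf⟩
  · obtain ⟨v, hv, rfl⟩ := mem_verts_map.1 hw
    exact hA (hfA hv)
  · by_cases hw : w ∈ (H.map f hf).verts
    · obtain ⟨v, hv, rfl⟩ := mem_verts_map.1 hw
      rw [edeg_map hf hv]
      exact (hdeg v hv).trans (hcount _ (hfA hv))
    · exact (edeg_eq_zero_of_notMem_verts hw).trans_le (Nat.zero_le _)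

/-! ### Edge-treewidth -/

theorem component_eq_singleton {G : Multigraph α} {S : Set α} {v : α}
    (h : ∀ w ∈ S, s(v, w) ∉ G.edges) : G.component S v = {v} := by
  refine Set.Subset.antisymm (fun w hw => ?_) (Set.singleton_subset_iff.2 .refl)
  induction hw with
  | refl => rfl
  | tail _ hstep ih => exact absurd (Set.mem_singleton_iff.1 ih ▸ hstep.2.2) (h _ hstep.2.1)

theorem cutSize_component_eq_zero {G : Multigraph α} {S : Set α} (hS : ↑G.verts ⊆ S) (v : α) :
    G.cutSize (G.component S v) = 0 := by
  classical
  rw [cutSize, boundary, Multiset.card_eq_zero, Multiset.filter_eq_nil]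
  rintro e he ⟨⟨x, hx, hxC⟩, y, hy, hyC⟩
  have hxy : s(x, y) = e :=
    ((Sym2.mem_and_mem_iff fun h : x = y => hyC (h ▸ hxC)).1 ⟨hx, hy⟩).symm
  exact hyC (hxC.tail ⟨hS (G.mem_verts e he x hx), hS (G.mem_verts e he y hy), hxy ▸ he⟩)

instance (G : Multigraph α) : Nonempty G.Layout :=
  ⟨G.verts.equivFin.symm⟩

theorem Layout.exists_apply_eq {G : Multigraph α} (i : Fin G.verts.card) (v : G.verts) :
    ∃ L : G.Layout, L i = v :=
  ⟨G.verts.equivFin.symm.setValue i v, Equiv.setValue_eq _ _ _⟩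

theorem le_etw_of_forall_le_edeg {G : Multigraph α} {k : ℕ} (hne : G.verts.Nonempty)
    (hdeg : ∀ v ∈ G.verts, k ≤ G.edeg v) : k ≤ G.etw := by
  refine le_ciInf fun L => ?_
  have : NeZero G.verts.card := ⟨hne.card_ne_zero⟩
  have hcomponent : G.component (L.suffix ⊤) (L ⊤) = {(L ⊤ : α)} := by
    refine component_eq_singleton ?_
    rintro _ ⟨j, hj, rfl⟩ hmem
    exact G.loopless _ hmem (Sym2.mk_isDiag_iff.2 (by rw [top_le_iff.1 hj]))
  calc k ≤ G.edeg (L ⊤) := hdeg _ (L ⊤).2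
    _ = L.cost ⊤ := by rw [Layout.cost, hcomponent, edeg]
    _ ≤ L.width := Finset.le_sup (f := L.cost) (Finset.mem_univ _)

/-- `G` is a star with centre `c`: all edges, possibly parallel, are incident with `c`. -/
def IsStar (G : Multigraph α) (c : α) : Prop :=
  c ∈ G.verts ∧ ∀ e ∈ G.edges, c ∈ e

namespace IsStar

variable {G : Multigraph α} {c : α}

theorem edeg_eq_count [DecidableEq α] (hG : G.IsStar c) {v : α} (hv : v ≠ c) :
    G.edeg v = G.edges.count s(c, v) := by
  rw [edeg_eq_countP, Multiset.count]
  refine Multiset.countP_congr rfl fun e he => eq_iff_iff.2 ?_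
  rw [eq_comm (a := s(c, v)), ← Sym2.mem_and_mem_iff hv.symm]
  exact (and_iff_right (hG.2 e he)).symm

theorem etw_le (hG : G.IsStar c) {k : ℕ} (hdeg : ∀ v ∈ G.verts, v ≠ c → G.edeg v ≤ k) :
    G.etw ≤ k := by
  have : NeZero G.verts.card := ⟨(Finset.card_pos.2 ⟨c, hG.1⟩).ne'⟩
  obtain ⟨L, hL⟩ := Layout.exists_apply_eq (G := G) 0 ⟨c, hG.1⟩
  refine (ciInf_le' _ L).trans (Finset.sup_le fun i _ => ?_)
  rw [Layout.cost]
  rcases eq_or_ne i 0 with rfl | hi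
  · have hsuffix : ↑G.verts ⊆ L.suffix 0 := fun x hx =>
      ⟨L.symm ⟨x, hx⟩, Fin.zero_le _, by simp⟩
    exact (cutSize_component_eq_zero hsuffix _).trans_le (Nat.zero_le k)
  · have hne_center : ∀ j, i ≤ j → (L j : α) ≠ c := fun j hij hj => by
      have hj0 : j = 0 := L.injective (hL ▸ Subtype.ext hj)
      exact hi (le_antisymm (hj0 ▸ hij) (Fin.zero_le i))
    rw [component_eq_singleton]
    · exact hdeg _ (L i).2 (hne_center i le_rfl)
    · rintro _ ⟨j, hij, rfl⟩ hmem
      rcases Sym2.mem_iff.1 (hG.2 _ hmem) with h | h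
      · exact hne_center i le_rfl h.symm
      · exact hne_center j hij h.symm

end IsStar

/-! ### 3-centers -/

theorem mem_boundary_singleton {H : Multigraph β} {v : β} {e : Sym2 β}
    (he : e ∈ H.boundary {v}) : e ∈ H.edges ∧ v ∈ e := by
  classical
  obtain ⟨heH, ⟨x, hx, rfl⟩, -⟩ := Multiset.mem_filter.1 he
  exact ⟨heH, hx⟩

theorem exists_isSuppression {H : Multigraph β} {v : β} (hv : v ∈ H.verts)
    (hdeg : H.edeg v ≤ 2) : ∃ H', IsSuppression H v H' := by
  classical
  have exists_erase : ∀ E : Multiset (Sym2 β),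
      (∀ e ∈ E, (∀ w ∈ e, w ≠ v ∧ w ∈ H.verts) ∧ ¬ e.IsDiag) →
        ∃ H' : Multigraph β, H'.verts = H.verts.erase v ∧
          H'.edges = E + H.edges.filter (v ∉ ·) := fun E hE =>
    ⟨{ verts := H.verts.erase v
       edges := E + H.edges.filter (v ∉ ·)
       mem_verts := fun e he w hw => by
         rcases Multiset.mem_add.1 he with he | he
         · exact Finset.mem_erase.2 ((hE e he).1 w hw)
         · obtain ⟨he, hve⟩ := Multiset.mem_filter.1 he
           exact Finset.mem_erase.2 ⟨fun h => hve (h ▸ hw), H.mem_verts e he w hw⟩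
       loopless := fun e he => (Multiset.mem_add.1 he).elim (fun he => (hE e he).2)
         fun he => H.loopless e (Multiset.mem_of_mem_filter he) }, rfl, rfl⟩
  rcases Nat.le_or_eq_of_le_succ hdeg with hdeg | hdeg
  · obtain ⟨H', hverts, hedges⟩ := exists_erase 0 (by simp)
    exact ⟨H', hv, by convert hverts, Or.inl ⟨hdeg, by simpa using hedges⟩⟩
  · obtain ⟨e, f, hef⟩ := Multiset.card_eq_two.1 hdeg
    obtain ⟨he, hve⟩ := mem_boundary_singleton (H := H) (v := v) (e := e) (by simp [hef])
    obtain ⟨hf, hvf⟩ := mem_boundary_singleton (H := H) (v := v) (e := f) (by simp [hef])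
    obtain ⟨a, rfl⟩ := Sym2.mem_iff_exists.1 hve
    obtain ⟨b, rfl⟩ := Sym2.mem_iff_exists.1 hvf
    have ha : a ≠ v ∧ a ∈ H.verts :=
      ⟨fun h => H.loopless _ he (by simp [h]), H.mem_verts _ he a (by simp)⟩
    have hb : b ≠ v ∧ b ∈ H.verts :=
      ⟨fun h => H.loopless _ hf (by simp [h]), H.mem_verts _ hf b (by simp)⟩
    obtain ⟨H', hverts, hedges⟩ := exists_erase (if a = b then 0 else {s(a, b)}) (by
      split_ifs with hab <;> simp [ha, hb, hab])
    exact ⟨H', hv, by convert hverts, Or.inr ⟨a, b, hef, by convert hedges⟩⟩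

theorem exists_isThreeCenter (H : Multigraph β) (X : Set β) : ∃ K, IsThreeCenter H X K := by
  classical
  induction hn : H.verts.card using Nat.strong_induction_on generalizing H with
  | _ n ih =>
    by_cases h : ∀ v ∈ H.verts, v ∉ X → 3 ≤ H.edeg v
    · exact ⟨H, .refl, h⟩
    · push Not at h
      obtain ⟨v, hv, hvX, hdeg⟩ := h
      obtain ⟨H', hH'⟩ := exists_isSuppression hv (Nat.le_of_lt_succ hdeg)
      have hcard : H'.verts.card < n := by
        rw [hH'.2.1, ← hn]
        exact Finset.card_erase_lt_of_mem hv
      obtain ⟨K, hK⟩ := ih _ hcard H' rfl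
      exact ⟨K, .head ⟨v, hvX, hH'⟩ hK.1, hK.2⟩

theorem exists_isThreeCenter_card_eq (H : Multigraph β) (X : Set β) :
    ∃ K, IsThreeCenter H X K ∧ K.verts.card = threeCenterSize H X :=
  have ⟨K, hK⟩ := exists_isThreeCenter H X
  Nat.sInf_mem (s := {n | ∃ K, IsThreeCenter H X K ∧ K.verts.card = n}) ⟨_, K, hK, rfl⟩

theorem threeCenterSize_le_card_verts {H : Multigraph β} {X : Set β} (h : ↑H.verts ⊆ X) :
    threeCenterSize H X ≤ H.verts.card :=
  Nat.sInf_le ⟨H, ⟨.refl, fun _ hv hvX => absurd (h hv) hvX⟩, rfl⟩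

theorem IsSuppression.edeg_le_two {H K : Multigraph β} {v : β} (h : IsSuppression H v K) :
    H.edeg v ≤ 2 := by
  obtain ⟨-, -, ⟨hdeg, -⟩ | ⟨a, b, hab, -⟩⟩ := h
  · exact hdeg.trans one_le_two
  · simp [edeg, cutSize, hab]

theorem IsSuppression.edges_eq {H K : Multigraph β} {v : β} (h : IsSuppression H v K)
    (hv : H.edeg v = 0) : K.edges = H.edges := by
  classical
  obtain ⟨-, -, ⟨-, hK⟩ | ⟨a, b, hab, -⟩⟩ := h
  · rw [hK, Multiset.filter_eq_self]
    exact edeg_eq_zero_iff.1 hv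
  · simp [edeg, cutSize, hab] at hv

theorem IsThreeCenter.edges_eq {H K : Multigraph β} {X : Set β} (h : IsThreeCenter H X K)
    (hX : ∀ v ∉ X, H.edeg v ≤ 2 → H.edeg v = 0) : K.edges = H.edges := by
  obtain ⟨hred, -⟩ := h
  induction hred with
  | refl => rfl
  | tail _ hstep ih =>
    obtain ⟨v, hvX, hs⟩ := hstep
    have hdeg := edeg_congr ih v
    exact (hs.edges_eq (hdeg ▸ hX v hvX (hdeg ▸ hs.edeg_le_two))).trans ih

/-! ### Tree-cut width -/

theorem exists_adj_connectedComponentMk_eq {V : Type*} {T : SimpleGraph V} (hT : T.Connected)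
    {t : V} (B : (T.induce {t}ᶜ).ConnectedComponent) :
    ∃ u : ({t}ᶜ : Set V), T.Adj t u ∧ (T.induce {t}ᶜ).connectedComponentMk u = B := by
  induction B using SimpleGraph.ConnectedComponent.ind with
  | _ b =>
    obtain ⟨b, hb⟩ := b
    obtain ⟨p, hp⟩ := (hT t b).exists_isPath
    cases p with
    | nil => exact absurd rfl hb
    | cons hadj q =>
      have hq : ∀ x ∈ q.support, x ∈ ({t}ᶜ : Set V) := fun x hx hxt =>
        ((SimpleGraph.Walk.cons_isPath_iff _ _).1 hp).2 (Set.mem_singleton_iff.1 hxt ▸ hx)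
      exact ⟨_, hadj, SimpleGraph.ConnectedComponent.sound (q.induce _ hq).reachable⟩

theorem reachable_deleteEdges_of_reachable_induce_compl {V : Type*} {T : SimpleGraph V} {t u : V}
    {a b : ({t}ᶜ : Set V)} (h : (T.induce {t}ᶜ).Reachable a b) :
    (T.deleteEdges {s(u, t)}).Reachable a b := by
  refine h.map ⟨Subtype.val, fun {x y} hxy => ?_⟩
  refine (SimpleGraph.deleteEdges_adj ..).2 ⟨hxy, fun hmem => ?_⟩
  have ht : t ∈ s(x.1, y.1) := Set.mem_singleton_iff.1 hmem ▸ Sym2.mem_mk_right u t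
  exact (Sym2.mem_iff.1 ht).elim (fun h => x.2 h.symm) fun h => y.2 h.symm

namespace TreeCutDecomposition

variable {G : Multigraph α} (D : TreeCutDecomposition G)

theorem adhesion_le_width {u v : Fin D.size} (h : D.tree.Adj u v) : D.adhesion u v ≤ D.width := by
  classical
  exact le_max_of_le_left (Finset.le_sup (f := fun p : Fin D.size × Fin D.size =>
    D.adhesion p.1 p.2) (b := (u, v)) (by simpa using h))

theorem threeCenterSize_le_width (t : Fin D.size) :
    threeCenterSize (D.torso t) (D.core t) ≤ D.width :=
  le_max_of_le_right (Finset.le_sup (f := fun t => threeCenterSize (D.torso t) (D.core t))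
    (Finset.mem_univ t))

theorem toTorso_eq_inl_iff {t : Fin D.size} {x y : α} :
    D.toTorso t x = Sum.inl y ↔ D.home x = t ∧ x = y := by
  unfold toTorso
  split_ifs with h <;> simp [h]

theorem mem_edges_torso {t : Fin D.size} {e : Sym2 (α ⊕ D.Branch t)} :
    e ∈ (D.torso t).edges ↔ (∃ f ∈ G.edges, f.map (D.toTorso t) = e) ∧ ¬ e.IsDiag := by
  classical
  rw [torso, Multiset.mem_filter, Multiset.mem_map]

open Classical in
theorem count_le_edeg_torso {t : Fin D.size} {x y : α}
    (h : D.toTorso t x ≠ D.toTorso t y) :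
    G.edges.count s(x, y) ≤ (D.torso t).edeg (D.toTorso t y) := by
  calc G.edges.count s(x, y) = G.edges.countP (s(x, y) = ·) := rfl
    _ ≤ G.edges.countP fun e => s(x, y).map (D.toTorso t) = e.map (D.toTorso t) := by
        rw [Multiset.countP_eq_card_filter, Multiset.countP_eq_card_filter]
        exact Multiset.card_le_card (Multiset.monotone_filter_right _ fun _ h => congrArg _ h)
    _ = (D.torso t).edges.count (s(x, y).map (D.toTorso t)) := by
        rw [torso, Multiset.count_filter_of_pos (by simpa using h), Multiset.count_map,
          Multiset.countP_eq_card_filter]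
    _ ≤ (D.torso t).edeg (D.toTorso t y) := count_le_edeg _ (by simp)

theorem notMem_side_of_home_eq {t u : Fin D.size} (h : D.tree.Adj t u) {x : α}
    (hx : D.home x = t) : x ∉ D.side u t := by
  have hbridge := SimpleGraph.isAcyclic_iff_forall_adj_isBridge.1 D.isTree.isAcyclic h.symm
  rw [SimpleGraph.isBridge_iff] at hbridge
  subst hx
  exact fun hside => hbridge (SimpleGraph.Reachable.symm hside)

theorem exists_adj_forall_mem_side {t : Fin D.size} (B : D.Branch t) :
    ∃ u, D.tree.Adj t u ∧ ∀ x, D.toTorso t x = Sum.inr B → x ∈ D.side u t := by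
  obtain ⟨u, hadj, rfl⟩ := exists_adj_connectedComponentMk_eq D.isTree.connected B
  refine ⟨u, hadj, fun x hx => ?_⟩
  unfold toTorso at hx
  split_ifs at hx with hxt
  exact reachable_deleteEdges_of_reachable_induce_compl
    (SimpleGraph.ConnectedComponent.exact (Sum.inr_injective hx))

end TreeCutDecomposition

/-- The tree-cut decomposition whose tree has a single node. -/
def trivialDecomposition (G : Multigraph α) : TreeCutDecomposition G where
  size := 1
  tree := ⊥
  isTree := .of_subsingleton
  home := fun _ => 0

instance (G : Multigraph α) : Nonempty (TreeCutDecomposition G) :=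
  ⟨G.trivialDecomposition⟩

theorem verts_torso_trivialDecomposition (G : Multigraph α)
    (t : Fin G.trivialDecomposition.size)
    [DecidableEq (α ⊕ G.trivialDecomposition.Branch t)] :
    (G.trivialDecomposition.torso t).verts = G.verts.image Sum.inl := by
  have : IsEmpty (G.trivialDecomposition.Branch t) :=
    ⟨fun B => B.ind fun v => v.2 (Subsingleton.elim (α := Fin 1) _ _)⟩
  have hhome : ∀ x, G.trivialDecomposition.home x = t := fun _ =>
    Subsingleton.elim (α := Fin 1) _ _
  ext (x | B)
  · simp [TreeCutDecomposition.torso, hhome]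
  · exact isEmptyElim B

theorem tcw_le_card_verts (G : Multigraph α) : G.tcw ≤ G.verts.card := by
  classical
  refine (ciInf_le' _ G.trivialDecomposition).trans
    (max_le (Finset.sup_le fun p hp => ?_) (Finset.sup_le fun t _ => ?_))
  · exact absurd (Finset.mem_filter.1 hp).2 (by simp [trivialDecomposition])
  · have hverts := G.verts_torso_trivialDecomposition t
    have hcore : ↑(G.trivialDecomposition.torso t).verts ⊆ G.trivialDecomposition.core t := by
      intro w hw
      rw [hverts] at hw
      obtain ⟨x, hx, rfl⟩ := Finset.mem_image.1 hw
      exact ⟨x, hx, Subsingleton.elim (α := Fin 1) _ _, rfl⟩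
    calc _ ≤ (G.trivialDecomposition.torso t).verts.card := threeCenterSize_le_card_verts hcore
      _ ≤ G.verts.card := hverts ▸ Finset.card_image_le

theorem card_le_cutSize {G : Multigraph α} {S : Set α} {c : α} (hc : c ∉ S) (A : Finset α)
    (hAS : ↑A ⊆ S) (hA : ∀ v ∈ A, s(c, v) ∈ G.edges) : A.card ≤ G.cutSize S := by
  classical
  have hsub : A.image (s(c, ·)) ⊆ (G.boundary S).toFinset := by
    intro e he
    obtain ⟨v, hv, rfl⟩ := Finset.mem_image.1 he
    exact Multiset.mem_toFinset.2 (Multiset.mem_filter.2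
      ⟨hA v hv, ⟨v, Sym2.mem_mk_right c v, hAS hv⟩, c, Sym2.mem_mk_left c v, hc⟩)
  calc A.card = (A.image (s(c, ·))).card :=
        (Finset.card_image_of_injective _ fun _ _ h => Sym2.congr_right.1 h).symm
    _ ≤ (G.boundary S).toFinset.card := Finset.card_le_card hsub
    _ ≤ G.cutSize S := Multiset.toFinset_card_le _

namespace IsStar

variable {G : Multigraph α} {c : α}

theorem three_le_edeg_torso (hG : G.IsStar c) (hdeg : ∀ v ∈ G.verts, v ≠ c → 3 ≤ G.edeg v)
    (D : TreeCutDecomposition G) {v : α} (hv : v ∈ G.verts) (hvc : v ≠ c) :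
    3 ≤ (D.torso (D.home c)).edeg (D.toTorso (D.home c) v) := by
  classical
  have htoTorso : D.toTorso (D.home c) c ≠ D.toTorso (D.home c) v := fun h =>
    hvc (D.toTorso_eq_inl_iff.1 (h.symm.trans (D.toTorso_eq_inl_iff.2 ⟨rfl, rfl⟩))).2
  calc 3 ≤ G.edges.count s(c, v) := hG.edeg_eq_count hvc ▸ hdeg v hv hvc
    _ ≤ _ := D.count_le_edeg_torso htoTorso

theorem edeg_torso_eq_zero (hG : G.IsStar c) (hdeg : ∀ v ∈ G.verts, v ≠ c → 3 ≤ G.edeg v)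
    (D : TreeCutDecomposition G) {w : α ⊕ D.Branch (D.home c)} (hw : w ∉ D.core (D.home c))
    (hwdeg : (D.torso (D.home c)).edeg w ≤ 2) : (D.torso (D.home c)).edeg w = 0 := by
  refine edeg_eq_zero_iff.2 fun e he hwe => ?_
  obtain ⟨⟨f, hf, rfl⟩, -⟩ := D.mem_edges_torso.1 he
  obtain ⟨v, hvf, rfl⟩ := Sym2.mem_map.1 hwe
  rcases eq_or_ne v c with rfl | hvc
  · exact hw ⟨v, hG.1, rfl, D.toTorso_eq_inl_iff.2 ⟨rfl, rfl⟩⟩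
  · have := hG.three_le_edeg_torso hdeg D (G.mem_verts f hf v hvf) hvc
    omega

theorem card_filter_toTorso_le (hG : G.IsStar c) (hdeg : ∀ v ∈ G.verts, v ≠ c → 3 ≤ G.edeg v)
    (D : TreeCutDecomposition G) [DecidableEq α] [DecidableEq (α ⊕ D.Branch (D.home c))]
    (w : α ⊕ D.Branch (D.home c)) :
    ((G.verts.erase c).filter fun v => D.toTorso (D.home c) v = w).card ≤ D.width + 1 := by
  rcases w with x | B
  · refine (Finset.card_le_one.2 fun a ha b hb => ?_).trans (Nat.le_add_left 1 _)
    rw [Finset.mem_filter, D.toTorso_eq_inl_iff] at ha hb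
    exact ha.2.2.trans hb.2.2.symm
  · obtain ⟨u, hadj, hside⟩ := D.exists_adj_forall_mem_side B
    calc _ ≤ D.adhesion u (D.home c) := card_le_cutSize
          (D.notMem_side_of_home_eq hadj rfl) _
          (fun v hv => hside v (Finset.mem_filter.1 hv).2) fun v hv => ?_
      _ ≤ D.width := D.adhesion_le_width hadj.symm
      _ ≤ D.width + 1 := Nat.le_succ _
    obtain ⟨hvc, hvG⟩ := Finset.mem_erase.1 (Finset.mem_filter.1 hv).1
    rw [← Multiset.one_le_count_iff_mem, ← hG.edeg_eq_count hvc]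
    exact le_trans (by omega) (hdeg v hvG hvc)

theorem card_verts_erase_le [DecidableEq α] (hG : G.IsStar c)
    (hdeg : ∀ v ∈ G.verts, v ≠ c → 3 ≤ G.edeg v) (D : TreeCutDecomposition G) :
    (G.verts.erase c).card ≤ (D.width + 1) * D.width := by
  classical
  obtain ⟨K, hK, hcard⟩ :=
    exists_isThreeCenter_card_eq (D.torso (D.home c)) (D.core (D.home c))
  have hedges : K.edges = (D.torso (D.home c)).edges :=
    hK.edges_eq fun _ => hG.edeg_torso_eq_zero hdeg D
  have hmaps : ∀ v ∈ G.verts.erase c, D.toTorso (D.home c) v ∈ K.verts := fun v hv => by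
    obtain ⟨hvc, hvG⟩ := Finset.mem_erase.1 hv
    by_contra hvK
    have := hG.three_le_edeg_torso hdeg D hvG hvc
    rw [← edeg_congr hedges, edeg_eq_zero_of_notMem_verts hvK] at this
    omega
  calc (G.verts.erase c).card ≤ (D.width + 1) * K.verts.card :=
        Finset.card_le_mul_card_image_of_maps_to hmaps _ fun w _ =>
          hG.card_filter_toTorso_le hdeg D w
    _ ≤ (D.width + 1) * D.width :=
        Nat.mul_le_mul_left _ (hcard.trans_le (D.threeCenterSize_le_width _))

theorem card_verts_erase_le_tcw [DecidableEq α] (hG : G.IsStar c)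
    (hdeg : ∀ v ∈ G.verts, v ≠ c → 3 ≤ G.edeg v) :
    (G.verts.erase c).card ≤ (G.tcw + 1) * G.tcw := by
  obtain ⟨D, hD⟩ := ciInf_mem fun D : TreeCutDecomposition G => D.width
  exact (hG.card_verts_erase_le hdeg D).trans_eq (by simp only [tcw, hD])

end IsStar

/-! ### Thetas and bouquets of thetas -/

theorem edeg_theta (i : ℕ) (b : Bool) : (theta i).edeg b = i := by
  rw [edeg_eq_countP, Multiset.countP_eq_card.2]
  · exact Multiset.card_replicate i _
  · intro e he
    rw [Multiset.eq_of_mem_replicate he]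
    cases b <;> simp

theorem le_etw_theta (i : ℕ) : i ≤ (theta i).etw :=
  le_etw_of_forall_le_edeg Finset.univ_nonempty fun v _ => (edeg_theta i v).ge

theorem isStar_thetaBouquet (n : ℕ) : (thetaBouquet n).IsStar none := by
  refine ⟨Finset.mem_univ _, fun e he => ?_⟩
  obtain ⟨j, -, hj⟩ := Multiset.mem_sum.1 (show e ∈ ∑ j : Fin n, _ from he)
  exact Multiset.eq_of_mem_replicate hj ▸ Sym2.mem_mk_left _ _

theorem count_edges_thetaBouquet {n : ℕ} (j : Fin n) :
    (thetaBouquet n).edges.count s(none, some j) = 3 := by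
  have hcount : ∀ k : Fin n, (Multiset.replicate 3 s(none, some k)).count s(none, some j) =
      if k = j then 3 else 0 := fun k => by
    simp only [Multiset.count_replicate, Sym2.congr_right, Option.some_inj]
  rw [thetaBouquet, Multiset.count_sum', Finset.sum_congr rfl fun k _ => hcount k,
    Finset.sum_ite_eq' _ _ fun _ => 3, if_pos (Finset.mem_univ j)]

theorem edeg_thetaBouquet {n : ℕ} {v : Option (Fin n)} (hv : v ≠ none) :
    (thetaBouquet n).edeg v = 3 := by
  obtain ⟨j, rfl⟩ := Option.ne_none_iff_exists'.1 hv
  rw [(isStar_thetaBouquet n).edeg_eq_count hv, count_edges_thetaBouquet]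

theorem etw_thetaBouquet_le (n : ℕ) : (thetaBouquet n).etw ≤ 3 :=
  (isStar_thetaBouquet n).etw_le fun _ _ hv => (edeg_thetaBouquet hv).le

theorem le_tcw_thetaBouquet (n : ℕ) :
    n ≤ ((thetaBouquet n).tcw + 1) * (thetaBouquet n).tcw :=
  calc n = ((thetaBouquet n).verts.erase none).card := by
        rw [Finset.card_erase_of_mem (isStar_thetaBouquet n).1]
        simp [thetaBouquet]
    _ ≤ _ := (isStar_thetaBouquet n).card_verts_erase_le_tcw fun _ _ hv =>
        (edeg_thetaBouquet hv).ge

theorem lt_tcw_thetaBouquet {n k : ℕ} (h : (k + 1) * k < n) : k < (thetaBouquet n).tcw := by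
  by_contra! hk
  exact h.not_ge ((le_tcw_thetaBouquet n).trans (Nat.mul_le_mul (Nat.succ_le_succ hk) hk))

theorem isImmersion_thetaBouquet {H : Multigraph β} {n : ℕ} (hn : H.verts.card ≤ n)
    (hdeg : ∀ v ∈ H.verts, H.edeg v ≤ 3) : IsImmersion H (thetaBouquet n) := by
  refine isImmersion_of_forall_le_count (c := none) (A := Finset.univ.map .some)
    (Finset.subset_univ _) (by simpa using hn) hdeg fun a ha => ?_
  obtain ⟨j, -, rfl⟩ := Finset.mem_map.1 ha
  exact (count_edges_thetaBouquet j).ge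

/-! ### Walls -/

theorem edges_induce_le (G : Multigraph α) (S : Set α) : (G.induce S).edges ≤ G.edges := by
  classical
  exact Multiset.filter_le _ _

theorem mem_verts_induce {G : Multigraph α} {S : Set α} {v : α} :
    v ∈ (G.induce S).verts ↔ v ∈ G.verts ∧ v ∈ S := by
  classical
  exact Finset.mem_filter

theorem countP_exists_mem_le_sum_edeg [DecidableEq α] (G : Multigraph α) (s : Finset α) :
    G.edges.countP (fun e => ∃ v ∈ s, v ∈ e) ≤ ∑ v ∈ s, G.edeg v := by
  simp_rw [edeg_eq_countP, Multiset.countP_eq_card_filter, ← Multiset.card_sum]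
  refine Multiset.card_le_card (Multiset.le_iff_count.2 fun e => ?_)
  rw [Multiset.count_sum', Multiset.count_filter]
  split_ifs with h
  · obtain ⟨v, hv, hve⟩ := h
    calc G.edges.count e = (G.edges.filter (v ∈ ·)).count e :=
          (Multiset.count_filter_of_pos (p := (v ∈ ·)) hve).symm
      _ ≤ _ := Finset.single_le_sum (f := fun v => (G.edges.filter (v ∈ ·)).count e)
          (fun _ _ => Nat.zero_le _) hv
  · exact Nat.zero_le _

open Classical in
theorem card_edges_le_card_edges_induce_add (G : Multigraph α) (S : Set α) :
    G.edges.card ≤ (G.induce S).edges.card + ∑ v ∈ G.verts.filter (· ∉ S), G.edeg v := by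
  calc G.edges.card = (G.induce S).edges.card +
        G.edges.countP fun e => ¬ ∀ v ∈ e, v ∈ S := by
        rw [Multiset.countP_eq_card_filter, ← Multiset.card_add, induce, Multiset.filter_add_not]
    _ = (G.induce S).edges.card +
        G.edges.countP fun e => ∃ v ∈ G.verts.filter (· ∉ S), v ∈ e := by
        congr 1
        refine Multiset.countP_congr rfl fun e he => ?_
        have := G.mem_verts e he
        grind
    _ ≤ _ := Nat.add_le_add_left (G.countP_exists_mem_le_sum_edeg _) _

theorem card_verts_induce_le_card_edges_induce {G : Multigraph α} {S : Set α}
    (hG : G.verts.card ≤ G.edges.card) (hS : ∀ v ∈ G.verts, v ∉ S → G.edeg v ≤ 1) :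
    (G.induce S).verts.card ≤ (G.induce S).edges.card := by
  classical
  have hverts : (G.induce S).verts.card + (G.verts.filter (· ∉ S)).card = G.verts.card := by
    rw [induce, Finset.card_filter_add_card_filter_not]
  have hedges := G.card_edges_le_card_edges_induce_add S
  have hdeg : ∑ v ∈ G.verts.filter (· ∉ S), G.edeg v ≤ (G.verts.filter (· ∉ S)).card := by
    simpa using Finset.sum_le_card_nsmul (G.verts.filter (· ∉ S)) G.edeg 1
      fun v hv => hS v (Finset.mem_filter.1 hv).1 (Finset.mem_filter.1 hv).2
  omega

theorem brickLattice_adj {p q : ℕ × ℕ} (h : brickLattice.Adj p q) :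
    q = (p.1 + 1, p.2) ∨ q = (p.1 - 1, p.2) ∨
      q = (p.1, if Odd (p.1 + p.2) then p.2 - 1 else p.2 + 1) := by
  obtain ⟨x, y⟩ := p
  obtain ⟨x', y'⟩ := q
  simp only [brickLattice, SimpleGraph.fromRel_adj, Prod.mk.injEq, ne_eq] at h ⊢
  split_ifs with ho <;> grind

theorem brickLattice_adj_horizontal (x y : ℕ) : brickLattice.Adj (x, y) (x + 1, y) := by
  simp [brickLattice, SimpleGraph.fromRel_adj]

theorem brickLattice_adj_vertical {x y : ℕ} (h : Even (x + y)) :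
    brickLattice.Adj (x, y) (x, y + 1) := by
  rw [brickLattice, SimpleGraph.fromRel_adj]
  exact ⟨by simp, Or.inl (Or.inr ⟨rfl, Nat.not_odd_iff_even.2 h⟩)⟩

theorem nodup_edges_preWall (r : ℕ) : (preWall r).edges.Nodup :=
  Finset.nodup _

theorem mem_verts_preWall {r x y : ℕ} :
    (x, y) ∈ (preWall r).verts ↔ (1 ≤ x ∧ x ≤ 2 * r) ∧ 1 ≤ y ∧ y ≤ r := by
  simp [preWall, ofSimple]

theorem mem_edges_preWall {r : ℕ} {p q : ℕ × ℕ} :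
    s(p, q) ∈ (preWall r).edges ↔
      p ∈ (preWall r).verts ∧ q ∈ (preWall r).verts ∧ brickLattice.Adj p q := by
  simp only [preWall, ofSimple, Finset.mem_val, Finset.mem_filter, Finset.mk_mem_sym2_iff,
    SimpleGraph.mem_edgeSet, and_assoc]

theorem horizontal_mem_edges_preWall {r x y : ℕ} (hx : 1 ≤ x ∧ x < 2 * r) (hy : 1 ≤ y ∧ y ≤ r) :
    s((x, y), (x + 1, y)) ∈ (preWall r).edges :=
  mem_edges_preWall.2 ⟨mem_verts_preWall.2 (by omega), mem_verts_preWall.2 (by omega),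
    brickLattice_adj_horizontal x y⟩

theorem vertical_mem_edges_preWall {r x y : ℕ} (hx : 1 ≤ x ∧ x ≤ 2 * r) (hy : 1 ≤ y ∧ y < r)
    (hxy : Even (x + y)) : s((x, y), (x, y + 1)) ∈ (preWall r).edges :=
  mem_edges_preWall.2 ⟨mem_verts_preWall.2 (by omega), mem_verts_preWall.2 (by omega),
    brickLattice_adj_vertical hxy⟩

theorem edeg_preWall_le (r : ℕ) (v : ℕ × ℕ) : (preWall r).edeg v ≤ 3 := by
  rw [edeg_eq_countP, Multiset.countP_eq_card_filter]
  have hsub : (preWall r).edges.filter (v ∈ ·) ≤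
      ({s(v, (v.1 + 1, v.2)), s(v, (v.1 - 1, v.2)),
        s(v, (v.1, if Odd (v.1 + v.2) then v.2 - 1 else v.2 + 1))} : Multiset _) := by
    refine (Multiset.le_iff_subset ((nodup_edges_preWall r).filter _)).2 fun e he => ?_
    obtain ⟨he, hv⟩ := Multiset.mem_filter.1 he
    obtain ⟨w, rfl⟩ := Sym2.mem_iff_exists.1 hv
    have hadj := brickLattice_adj (mem_edges_preWall.1 he).2.2
    simpa only [Multiset.insert_eq_cons, Multiset.mem_cons, Multiset.mem_singleton,
      Sym2.congr_right] using hadj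
  exact Multiset.card_le_card hsub

theorem edeg_wall_le (r : ℕ) (v : ℕ × ℕ) : (wall r).edeg v ≤ 3 :=
  (edeg_mono (edges_induce_le _ _) v).trans (edeg_preWall_le r v)

theorem card_verts_preWall (r : ℕ) : (preWall r).verts.card = 2 * r * r := by
  simp [preWall, ofSimple]

/-- The edges `{(x, y), (x + 1, y)}` of `preWall r`. -/
noncomputable def horizontalEdges (r : ℕ) : Finset (Sym2 (ℕ × ℕ)) :=
  (Finset.Icc 1 (2 * r - 1) ×ˢ Finset.Icc 1 r).image fun p => s(p, (p.1 + 1, p.2))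

/-- The edges `{(x, y), (x, y + 1)}` of `preWall r`. In row `y` they leave from the columns
`x = 2 * k - y % 2` with `1 ≤ k ≤ r`, which are those with `x + y` even. -/
noncomputable def verticalEdges (r : ℕ) : Finset (Sym2 (ℕ × ℕ)) :=
  (Finset.Icc 1 r ×ˢ Finset.Icc 1 (r - 1)).image
    fun p => s((2 * p.1 - p.2 % 2, p.2), (2 * p.1 - p.2 % 2, p.2 + 1))

theorem card_horizontalEdges (r : ℕ) : (horizontalEdges r).card = (2 * r - 1) * r := by
  rw [horizontalEdges, Finset.card_image_of_injective]
  · simp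
  · rintro ⟨x, y⟩ ⟨x', y'⟩ h
    simp only [Sym2.eq_iff, Prod.mk.injEq] at h ⊢
    omega

theorem card_verticalEdges (r : ℕ) : (verticalEdges r).card = r * (r - 1) := by
  rw [verticalEdges, Finset.card_image_of_injOn]
  · simp
  · rintro ⟨x, y⟩ hp ⟨x', y'⟩ hp' h
    simp only [Finset.coe_product, Finset.coe_Icc, Set.mem_prod, Set.mem_Icc, Sym2.eq_iff,
      Prod.mk.injEq] at hp hp' h ⊢
    omega

theorem disjoint_horizontalEdges_verticalEdges (r : ℕ) :
    Disjoint (horizontalEdges r) (verticalEdges r) := by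
  simp only [horizontalEdges, verticalEdges, Finset.disjoint_left, Finset.mem_image, not_exists,
    not_and]
  rintro _ ⟨p, -, rfl⟩ q - h
  simp only [Sym2.eq_iff, Prod.ext_iff] at h
  omega

theorem horizontalEdges_subset (r : ℕ) : horizontalEdges r ⊆ (preWall r).edges.toFinset := by
  intro e he
  obtain ⟨⟨x, y⟩, hp, rfl⟩ := Finset.mem_image.1 he
  simp only [Finset.mem_product, Finset.mem_Icc] at hp
  exact Multiset.mem_toFinset.2 (horizontal_mem_edges_preWall (by omega) hp.2)

theorem verticalEdges_subset (r : ℕ) : verticalEdges r ⊆ (preWall r).edges.toFinset := by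
  intro e he
  obtain ⟨⟨k, y⟩, hp, rfl⟩ := Finset.mem_image.1 he
  simp only [Finset.mem_product, Finset.mem_Icc] at hp
  exact Multiset.mem_toFinset.2
    (vertical_mem_edges_preWall (by omega) (by omega) (Nat.even_iff.2 (by omega)))

theorem le_card_edges_preWall (r : ℕ) :
    (2 * r - 1) * r + r * (r - 1) ≤ (preWall r).edges.card :=
  calc (2 * r - 1) * r + r * (r - 1) = (horizontalEdges r ∪ verticalEdges r).card := by
        rw [Finset.card_union_of_disjoint (disjoint_horizontalEdges_verticalEdges r),
          card_horizontalEdges, card_verticalEdges]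
    _ ≤ (preWall r).edges.toFinset.card :=
        Finset.card_le_card
          (Finset.union_subset (horizontalEdges_subset r) (verticalEdges_subset r))
    _ ≤ (preWall r).edges.card := Multiset.toFinset_card_le _

theorem card_verts_preWall_le_card_edges {r : ℕ} (hr : 2 ≤ r) :
    (preWall r).verts.card ≤ (preWall r).edges.card := by
  refine le_trans ?_ (le_card_edges_preWall r)
  obtain ⟨k, rfl⟩ := Nat.exists_eq_add_of_le hr
  rw [card_verts_preWall, show 2 * (2 + k) - 1 = 2 * k + 3 by omega,
    show 2 + k - 1 = k + 1 by omega]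
  nlinarith

theorem card_verts_wall_le_card_edges {r : ℕ} (hr : 2 ≤ r) :
    (wall r).verts.card ≤ (wall r).edges.card :=
  card_verts_induce_le_card_edges_induce (card_verts_preWall_le_card_edges hr) fun _ _ hv =>
    (not_not.1 hv).le

theorem le_card_verts_wall (r : ℕ) : 2 * r - 2 ≤ (wall r).verts.card := by
  classical
  have hsub : (Finset.Icc 2 (2 * r - 1)).image (·, 1) ⊆ (wall r).verts := by
    intro p hp
    obtain ⟨x, hx, rfl⟩ := Finset.mem_image.1 hp
    rw [Finset.mem_Icc] at hx
    obtain ⟨x, rfl⟩ := Nat.exists_eq_add_of_le' (one_le_two.trans hx.1)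
    have hdeg : 2 ≤ (preWall r).edeg (x + 1, 1) :=
      two_le_edeg (horizontal_mem_edges_preWall (x := x) (y := 1) (by omega) (by omega))
        (horizontal_mem_edges_preWall (x := x + 1) (y := 1) (by omega) (by omega))
        (by grind) (Sym2.mem_mk_right _ _) (Sym2.mem_mk_left _ _)
    exact mem_verts_induce.2 ⟨mem_verts_preWall.2 (by omega), (Nat.lt_of_succ_le hdeg).ne'⟩
  calc 2 * r - 2 = ((Finset.Icc 2 (2 * r - 1)).image fun x => (x, 1)).card := by
        rw [Finset.card_image_of_injective _ (Prod.mk_left_injective 1), Nat.card_Icc]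
        omega
    _ ≤ _ := Finset.card_le_card hsub

theorem le_card_edges_wall {r : ℕ} (hr : 2 ≤ r) : r ≤ (wall r).edges.card := by
  have hverts := le_card_verts_wall r
  have hedges := card_verts_wall_le_card_edges hr
  omega

theorem IsImmersion.wall_le_card_verts {r : ℕ} {G : Multigraph α} (hr : 2 ≤ r)
    (h : IsImmersion (wall r) G) : r ≤ G.verts.card := by
  have hwall := le_card_verts_wall r
  have hG := h.card_verts_le
  omega

theorem wallImmersionNumber_le_card_verts (G : Multigraph α) :
    G.wallImmersionNumber ≤ G.verts.card := by
  rcases Set.eq_empty_or_nonempty {i | 2 ≤ i ∧ IsImmersion (wall i) G} with h | h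
  · rw [wallImmersionNumber, h, csSup_empty]
    exact Nat.zero_le _
  · exact csSup_le h fun i hi => hi.2.wall_le_card_verts hi.1

theorem IsImmersion.le_wallImmersionNumber {r : ℕ} {G : Multigraph α} (hr : 2 ≤ r)
    (h : IsImmersion (wall r) G) : r ≤ G.wallImmersionNumber :=
  le_csSup ⟨G.verts.card, fun _ hi => hi.2.wall_le_card_verts hi.1⟩ ⟨hr, h⟩

theorem isImmersion_wall_zGraph {r : ℕ} (hr : 2 ≤ r) : IsImmersion (wall r) (zGraph r) :=
  isImmersion_thetaBouquet (card_verts_wall_le_card_edges hr) fun v _ => edeg_wall_le r v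

theorem exists_lt_tcw_zGraph (k : ℕ) : ∃ i, 2 ≤ i ∧ k < (zGraph i).tcw := by
  have hi : 2 ≤ (k + 1) * k + 2 := Nat.le_add_left 2 _
  exact ⟨_, hi, lt_tcw_thetaBouquet (lt_of_lt_of_le (by omega) (le_card_edges_wall hi))⟩

end Multigraph

theorem GraphParameter.not_upperBounded_of_family {p q : GraphParameter} {ι : Type*}
    {V : ι → Type} {G : ∀ i, Multigraph (V i)} {c : ℕ} (hq : ∀ i, q (V i) (G i) ≤ c)
    (hp : ∀ k, ∃ i, k < p (V i) (G i)) : ¬ p.UpperBounded q := by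
  rintro ⟨f, hf⟩
  obtain ⟨i, hi⟩ := hp ((Finset.range (c + 1)).sup f)
  have hle : f (q (V i) (G i)) ≤ (Finset.range (c + 1)).sup f :=
    Finset.le_sup (Finset.mem_range_succ_iff.2 (hq i))
  exact hi.not_ge ((hf _ _).trans hle)

open Multigraph

theorem mainTheorem11 :
    -- the two parameters are incomparable
    GraphParameter.Incomparable GraphParameter.tcw GraphParameter.etw ∧
    -- so are edge-treewidth and the maximum size of an immersed wall
    GraphParameter.Incomparable GraphParameter.wallImmersion GraphParameter.etw ∧
    -- thetas have bounded tree-cut width and immersed walls, but unbounded edge-treewidth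
    (∃ c : ℕ, ∀ i : ℕ, 1 ≤ i → (Multigraph.theta i).tcw ≤ c) ∧
    (∃ c : ℕ, ∀ i : ℕ, 1 ≤ i → (Multigraph.theta i).wallImmersionNumber ≤ c) ∧
    (∀ k : ℕ, ∃ i : ℕ, 1 ≤ i ∧ k < (Multigraph.theta i).etw) ∧
    -- the graphs `Z_i` contain the walls as immersions, have unbounded tree-cut width,
    -- but bounded edge-treewidth
    (∀ i : ℕ, 2 ≤ i → Multigraph.IsImmersion (Multigraph.wall i) (Multigraph.zGraph i)) ∧
    (∀ i : ℕ, 2 ≤ i → i ≤ (Multigraph.zGraph i).wallImmersionNumber) ∧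
    (∀ k : ℕ, ∃ i : ℕ, 2 ≤ i ∧ k < (Multigraph.zGraph i).tcw) ∧
    (∃ c : ℕ, ∀ i : ℕ, 2 ≤ i → (Multigraph.zGraph i).etw ≤ c) := by
  have tcw_theta i : (theta i).tcw ≤ 2 := (theta i).tcw_le_card_verts
  have wall_theta i : (theta i).wallImmersionNumber ≤ 2 :=
    (theta i).wallImmersionNumber_le_card_verts
  have etw_theta k : ∃ i, 1 ≤ i ∧ k < (theta i).etw := ⟨k + 1, by omega, le_etw_theta (k + 1)⟩
  have wall_zGraph i (hi : 2 ≤ i) : i ≤ (zGraph i).wallImmersionNumber :=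
    (isImmersion_wall_zGraph hi).le_wallImmersionNumber hi
  have etw_zGraph i : (zGraph i).etw ≤ 3 := etw_thetaBouquet_le _
  refine ⟨⟨?_, ?_⟩, ⟨?_, ?_⟩, ⟨2, fun i _ => tcw_theta i⟩, ⟨2, fun i _ => wall_theta i⟩,
    etw_theta, fun i => isImmersion_wall_zGraph, wall_zGraph, exists_lt_tcw_zGraph,
    ⟨3, fun i _ => etw_zGraph i⟩⟩
  · exact GraphParameter.not_upperBounded_of_family tcw_theta fun k =>
      (etw_theta k).imp fun _ => And.right
  · exact GraphParameter.not_upperBounded_of_family etw_zGraph fun k =>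
      (exists_lt_tcw_zGraph k).imp fun _ => And.right
  · exact GraphParameter.not_upperBounded_of_family wall_theta fun k =>
      (etw_theta k).imp fun _ => And.right
  · exact GraphParameter.not_upperBounded_of_family etw_zGraph fun k =>
      ⟨k + 2, (by omega : k < k + 2).trans_le (wall_zGraph _ (by omega))⟩
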